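/- Let $a:[0,1]\to\mathbb R$ satisfy $a(0)=0$ and $a>0$ on $(0,1]$, and suppose that one of the following holds. (WD) $a\in C([0,1])\cap C^1((0,1])$ and there is $K\in[0,1)$ with $x a'(x)\le K a(x)$ for all $x\in(0,1]$. (SD) $a\in C^1([0,1])$ and there is $K\in[1,2)$ with $x a'(x)\le K a(x)$ for all $x\in[0,1]$, and such that $x\mapsto a(x)/x^{\theta}$ is nondecreasing near $0$ for some $\theta\in(1,K]$ if $K>1$, respectively for some $\theta\in(0,1)$ if $K=1$. Let $\mathcal M u=(a u_x)_x$ be the unbounded operator on $L^2(0,1)$ (real valued functions) with domain $H^2_a=\{u\in H^1_a: a u_x\in H^1(0,1)\}$, where in case (WD) $H^1_a$ is the set of $u\in L^2(0,1)$ that are absolutely continuous on $[0,1]$ with $\sqrt a\,u_x\in L^2(0,1)$ and $u(0)=u(1)=0$, and in case (SD) $H^1_a$ is the set of $u\in L^2(0,1)$ that are locally absolutely continuous on $(0,1]$ with $\sqrt a\,u_x\in L^2(0,1)$ and $u(1)=0$. Let $\mathbf D$ be a real $n\times n$ matrix of the form $\mathbf D=P^{-1}\,\mathrm{diag}(d_1,\dots,d_n)\,P$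 with $P$ real and invertible and all $d_i>0$, let $A$ be a real $n\times n$ matrix and $B$ a real $n\times m$ matrix. Put $L=\mathbf D\mathcal M+A$ and let $$\mathcal K=[L^{n-1}B\,|\,\cdots\,|\,LB\,|\,B],\qquad D(\mathcal K)=\{u\in L^2(0,1)^{nm}:\ \mathcal K u\in L^2(0,1)^n\}\to L^2(0,1)^n.$$ Here $\mathcal K u$ is understood in the generalized sense. Let $\mathbb D=\bigcap_{p\ge0}D(\mathcal M^p)$, embed $L^2(0,1)$ into the space $\mathbb D'$ of linear forms on $\mathbb D$ by $f\mapsto(f,\cdot)_{L^2(0,1)}$, and extend $\mathcal M$ to $\mathbb D'$ by $(\mathcal M\tau)(\varphi)=\tau(\mathcal M\varphi)$; then $\mathcal K u$ is computed in $(\mathbb D')^n$. Let $\mathcal K^*$ be the adjoint of the unbounded operator $\mathcal K$, and let $\mathcal K\mathcal K^*$ be the product, with domain $\{\varphi\in D(\mathcal K^*):\mathcal K^*\varphi\in D(\mathcal K)\}$. For each eigenvalue $\lambda_p$ of $-\mathcal M$ put $L_p=-\lambda_p\mathbf D+A$ and let $\mathcal K_p=[L_p^{n-1}B\,|\,\cdots\,|\,L_pB\,|\,B]$,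 a real $n\times nm$ matrix with transpose $\mathcal K_p^*$. Then the following three conditions are equivalent: 1. $\operatorname{Ker}(\mathcal K^*)=\{0\}$; 2. $\operatorname{Ker}(\mathcal K\mathcal K^*)=\{0\}$; 3. $\det(\mathcal K_p\mathcal K_p^*)\neq0$ for every eigenvalue $\lambda_p$ of $-\mathcal M$. -/

import Mathlib

open MeasureTheory Set
open scoped InnerProductSpace

noncomputable section

namespace DegenerateKalman

/-! ### The degenerate diffusion coefficient -/

/-- The two kinds of degeneracy of the diffusion coefficient at `0`. -/
inductive Degeneracy
  | weak
  | strong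

/-- Condition (WD) on the coefficient `a`. -/
def WeaklyDegenerate (a : ℝ → ℝ) : Prop :=
  ContinuousOn a (Icc 0 1) ∧ ContDiffOn ℝ 1 a (Ioc 0 1) ∧ (∀ x ∈ Ioc (0 : ℝ) 1, 0 < a x) ∧
    a 0 = 0 ∧
    ∃ K ∈ Ico (0 : ℝ) 1, ∀ x ∈ Ioc (0 : ℝ) 1, x * derivWithin a (Icc 0 1) x ≤ K * a x

/-- Condition (SD) on the coefficient `a`. -/
def StronglyDegenerate (a : ℝ → ℝ) : Prop :=
  ContDiffOn ℝ 1 a (Icc 0 1) ∧ (∀ x ∈ Ioc (0 : ℝ) 1, 0 < a x) ∧ a 0 = 0 ∧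
    ∃ K ∈ Ico (1 : ℝ) 2,
      (∀ x ∈ Icc (0 : ℝ) 1, x * derivWithin a (Icc 0 1) x ≤ K * a x) ∧
      (1 < K → ∃ θ ∈ Ioc (1 : ℝ) K, ∃ δ ∈ Ioc (0 : ℝ) 1,
        MonotoneOn (fun x => a x / x ^ θ) (Ioc 0 δ)) ∧
      (K = 1 → ∃ θ ∈ Ioo (0 : ℝ) 1, ∃ δ ∈ Ioc (0 : ℝ) 1,
        MonotoneOn (fun x => a x / x ^ θ) (Ioc 0 δ))

/-- `a` satisfies (WD), respectively (SD). -/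
def Degeneracy.Holds (κ : Degeneracy) (a : ℝ → ℝ) : Prop :=
  match κ with
  | .weak => WeaklyDegenerate a
  | .strong => StronglyDegenerate a

/-! ### The space `L²(0,1)` and the operator `𝓜 u = (a uₓ)ₓ` -/

/-- Lebesgue measure on `(0,1)`. -/
abbrev μ01 : Measure ℝ := volume.restrict (Ioo 0 1)

/-- The real Hilbert space `L²(0,1)`. -/
abbrev L2 : Type := Lp ℝ 2 μ01

/-- The Hilbert space `L²(0,1)^ι`, with its Euclidean product structure. -/
abbrev L2Vec (ι : Type) [Fintype ι] : Type := PiLp 2 (fun _ : ι => L2)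

/-- `W` is (the absolutely continuous representative of) a function in `H¹(0,1)`. -/
def IsH1 (W : ℝ → ℝ) : Prop :=
  AbsolutelyContinuousOnInterval W 0 1 ∧ MemLp (deriv W) 2 μ01

/-- The regularity and boundary conditions in the definition of the weighted space `H¹ₐ`
(apart from membership in `L²(0,1)`). In the strongly degenerate case, absolute continuity in
`(0,1]` means absolute continuity on every compact subinterval `[δ,1]`. -/
def IsH1a (κ : Degeneracy) (a U : ℝ → ℝ) : Prop :=
  (match κ with
    | .weak => AbsolutelyContinuousOnInterval U 0 1 ∧ U 0 = 0 ∧ U 1 = 0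
    | .strong => (∀ δ ∈ Ioc (0 : ℝ) 1, AbsolutelyContinuousOnInterval U δ 1) ∧ U 1 = 0) ∧
  MemLp (fun x => √(a x) * deriv U x) 2 μ01

/-- `u` lies in `H²ₐ` and `f = (a uₓ)ₓ`: the class `u ∈ L²(0,1)` has a representative `U` in
`H¹ₐ`, and `a Uₓ` coincides a.e. with a function `W ∈ H¹(0,1)`, whose derivative is `f`. -/
def IsM (κ : Degeneracy) (a : ℝ → ℝ) (u f : L2) : Prop :=
  ∃ U W : ℝ → ℝ, u =ᵐ[μ01] U ∧ IsH1a κ a U ∧ IsH1 W ∧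
    W =ᵐ[μ01] (fun x => a x * deriv U x) ∧ f =ᵐ[μ01] deriv W

theorem ae_differentiableAt_of_ac {U : ℝ → ℝ} {c : ℝ} (hc : c ≤ 1)
    (h : AbsolutelyContinuousOnInterval U c 1) :
    ∀ᵐ x, x ∈ Ioc c 1 → DifferentiableAt ℝ U x := by
  filter_upwards [h.boundedVariationOn.ae_differentiableAt_of_mem_uIcc] with x hx hxc
  exact hx (by rw [uIcc_of_le hc]; exact Ioc_subset_Icc_self hxc)

theorem IsH1.ae_differentiableAt {W : ℝ → ℝ} (h : IsH1 W) :
    ∀ᵐ x ∂μ01, DifferentiableAt ℝ W x := by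
  rw [ae_restrict_iff' measurableSet_Ioo]
  filter_upwards [ae_differentiableAt_of_ac zero_le_one h.1] with x hx hxc
  exact hx (Ioo_subset_Ioc_self hxc)

theorem IsH1a.ae_differentiableAt {κ : Degeneracy} {a U : ℝ → ℝ} (h : IsH1a κ a U) :
    ∀ᵐ x ∂μ01, DifferentiableAt ℝ U x := by
  rw [ae_restrict_iff' measurableSet_Ioo]
  cases κ with
  | weak =>
    filter_upwards [ae_differentiableAt_of_ac zero_le_one h.1.1] with x hx hxc
    exact hx (Ioo_subset_Ioc_self hxc)
  | strong =>
    have hn : ∀ n : ℕ, ∀ᵐ x, x ∈ Ioc (1 / ((n : ℝ) + 1)) 1 → DifferentiableAt ℝ U x := by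
      intro n
      have h1 : 1 / ((n : ℝ) + 1) ≤ 1 := by
        rw [div_le_one (by positivity)]
        linarith [(Nat.cast_nonneg n : (0 : ℝ) ≤ n)]
      exact ae_differentiableAt_of_ac h1 (h.1.1 _ ⟨by positivity, h1⟩)
    filter_upwards [ae_all_iff.2 hn] with x hx hxc
    obtain ⟨n, hn⟩ := exists_nat_one_div_lt hxc.1
    exact hx n ⟨hn, hxc.2.le⟩

theorem IsH1.add {V W : ℝ → ℝ} (hV : IsH1 V) (hW : IsH1 W) : IsH1 (V + W) := by
  refine ⟨hV.1.add hW.1, (hV.2.add hW.2).ae_eq ?_⟩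
  filter_upwards [hV.ae_differentiableAt, hW.ae_differentiableAt] with x h1 h2
  rw [deriv_add h1 h2, Pi.add_apply]

theorem IsH1.smul {W : ℝ → ℝ} (c : ℝ) (hW : IsH1 W) : IsH1 (c • W) := by
  refine ⟨hW.1.const_smul c, (hW.2.const_smul c).ae_eq ?_⟩
  filter_upwards [hW.ae_differentiableAt] with x h1
  rw [deriv_const_smul c h1, Pi.smul_apply]

theorem IsH1a.add {κ : Degeneracy} {a U V : ℝ → ℝ} (hU : IsH1a κ a U) (hV : IsH1a κ a V) :
    IsH1a κ a (U + V) := by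
  refine ⟨?_, (hU.2.add hV.2).ae_eq ?_⟩
  · cases κ with
    | weak => exact ⟨hU.1.1.add hV.1.1, by simp [hU.1.2.1, hV.1.2.1], by simp [hU.1.2.2, hV.1.2.2]⟩
    | strong => exact ⟨fun δ hδ => (hU.1.1 δ hδ).add (hV.1.1 δ hδ), by simp [hU.1.2, hV.1.2]⟩
  · filter_upwards [hU.ae_differentiableAt, hV.ae_differentiableAt] with x h1 h2
    rw [deriv_add h1 h2, Pi.add_apply, mul_add]

theorem IsH1a.smul {κ : Degeneracy} {a U : ℝ → ℝ} (c : ℝ) (hU : IsH1a κ a U) :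
    IsH1a κ a (c • U) := by
  refine ⟨?_, (hU.2.const_smul c).ae_eq ?_⟩
  · cases κ with
    | weak => exact ⟨hU.1.1.const_smul c, by simp [hU.1.2.1], by simp [hU.1.2.2]⟩
    | strong => exact ⟨fun δ hδ => (hU.1.1 δ hδ).const_smul c, by simp [hU.1.2]⟩
  · filter_upwards [hU.ae_differentiableAt] with x h1
    rw [deriv_const_smul c h1, Pi.smul_apply, smul_eq_mul, smul_eq_mul]
    ring

theorem isM_zero (κ : Degeneracy) (a : ℝ → ℝ) : IsM κ a 0 0 := by
  have h0 : AbsolutelyContinuousOnInterval (0 : ℝ → ℝ) 0 1 :=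
    (LipschitzWith.const' (K := 0) (0 : ℝ)).lipschitzOnWith.absolutelyContinuousOnInterval
  have hd : deriv (0 : ℝ → ℝ) = 0 := by ext x; exact deriv_const x 0
  refine ⟨0, 0, Lp.coeFn_zero _ _ _, ⟨?_, ?_⟩, ⟨h0, ?_⟩, ?_, ?_⟩
  · cases κ with
    | weak => exact ⟨h0, rfl, rfl⟩
    | strong =>
      refine ⟨fun δ hδ => h0.mono ?_, rfl⟩
      rw [uIcc_of_le hδ.2, uIcc_of_le zero_le_one]
      exact Icc_subset_Icc_left hδ.1.le
  · simp [hd]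
  · rw [hd]; exact MemLp.zero
  · rw [hd]; exact Filter.Eventually.of_forall fun x => by simp
  · rw [hd]; exact Lp.coeFn_zero _ _ _

theorem IsM.add {κ : Degeneracy} {a : ℝ → ℝ} {u f v g : L2} (h : IsM κ a u f)
    (h' : IsM κ a v g) : IsM κ a (u + v) (f + g) := by
  obtain ⟨U, W, hu, hU, hW, hWU, hf⟩ := h
  obtain ⟨V, Z, hv, hV, hZ, hZV, hg⟩ := h'
  refine ⟨U + V, W + Z, (Lp.coeFn_add u v).trans (hu.add hv), hU.add hV, hW.add hZ, ?_, ?_⟩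
  · filter_upwards [hWU, hZV, hU.ae_differentiableAt, hV.ae_differentiableAt] with x h1 h2 h3 h4
    rw [Pi.add_apply, h1, h2, deriv_add h3 h4, mul_add]
  · filter_upwards [Lp.coeFn_add f g, hf, hg, hW.ae_differentiableAt, hZ.ae_differentiableAt]
      with x h1 h2 h3 h4 h5
    rw [h1, Pi.add_apply, h2, h3, deriv_add h4 h5]

theorem IsM.smul {κ : Degeneracy} {a : ℝ → ℝ} {u f : L2} (c : ℝ) (h : IsM κ a u f) :
    IsM κ a (c • u) (c • f) := by
  obtain ⟨U, W, hu, hU, hW, hWU, hf⟩ := h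
  refine ⟨c • U, c • W, (Lp.coeFn_smul c u).trans (hu.const_smul c), hU.smul c, hW.smul c, ?_, ?_⟩
  · filter_upwards [hWU, hU.ae_differentiableAt] with x h1 h2
    rw [Pi.smul_apply, h1, deriv_const_smul c h2, smul_eq_mul, smul_eq_mul]
    ring
  · filter_upwards [Lp.coeFn_smul c f, hf, hW.ae_differentiableAt] with x h1 h2 h3
    rw [h1, Pi.smul_apply, h2, deriv_const_smul c h3]

/-- The graph of `𝓜`. -/
def graphM (κ : Degeneracy) (a : ℝ → ℝ) : Submodule ℝ (L2 × L2) where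
  carrier := {p | IsM κ a p.1 p.2}
  zero_mem' := isM_zero κ a
  add_mem' h h' := IsM.add h h'
  smul_mem' c _ h := IsM.smul c h

/-- The unbounded operator `𝓜 u = (a uₓ)ₓ` on `L²(0,1)`, with domain `H²ₐ`. -/
def opM (κ : Degeneracy) (a : ℝ → ℝ) : L2 →ₗ.[ℝ] L2 := (graphM κ a).toLinearPMap

/-! ### Unbounded operators: eigenvalues, kernel, products, powers -/

/-- `ev` is an eigenvalue of `-T`. -/
def IsEigenvalueNeg {H : Type*} [AddCommGroup H] [Module ℝ H] (T : H →ₗ.[ℝ] H) (ev : ℝ) : Prop :=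
  ∃ u : T.domain, (u : H) ≠ 0 ∧ -(T u) = ev • (u : H)

/-- The kernel of an unbounded operator. -/
def pker {E F : Type*} [AddCommGroup E] [Module ℝ E] [AddCommGroup F] [Module ℝ F]
    (T : E →ₗ.[ℝ] F) : Submodule ℝ E :=
  (LinearMap.ker T.toFun).map T.domain.subtype

/-- The product `S T` of unbounded operators, on `{x ∈ D(T) : T x ∈ D(S)}`. -/
def pcomp {E F G : Type*} [AddCommGroup E] [Module ℝ E] [AddCommGroup F] [Module ℝ F]
    [AddCommGroup G] [Module ℝ G] (S : F →ₗ.[ℝ] G) (T : E →ₗ.[ℝ] F) : E →ₗ.[ℝ] G where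
  domain := (S.domain.comap T.toFun).map T.domain.subtype
  toFun := S.toFun ∘ₗ
    (T.toFun ∘ₗ Submodule.inclusion (Submodule.map_subtype_le _ _)).codRestrict S.domain (by
      rintro ⟨x, hx⟩
      obtain ⟨y, hy, rfl⟩ := hx
      exact hy)

/-- `D(T^p)`: `D(T^0)` is the whole space, and
`D(T^(p+1)) = {u ∈ D(T) : T u ∈ D(T^p)}`. -/
def powDomain {H : Type*} [AddCommGroup H] [Module ℝ H] (T : H →ₗ.[ℝ] H) : ℕ → Submodule ℝ H
  | 0 => ⊤
  | p + 1 => ((powDomain T p).comap T.toFun).map T.domain.subtype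

/-- The space `𝔻 = ⋂ₚ D(T^p)`. -/
def smoothSpace {H : Type*} [AddCommGroup H] [Module ℝ H] (T : H →ₗ.[ℝ] H) : Submodule ℝ H :=
  ⨅ p, powDomain T p

section
variable {H : Type*} [AddCommGroup H] [Module ℝ H] (T : H →ₗ.[ℝ] H)

theorem smoothSpace_le_domain : smoothSpace T ≤ T.domain := by
  intro x hx
  obtain ⟨y, -, rfl⟩ := (Submodule.mem_iInf _).1 hx 1
  exact y.2

theorem map_mem_smoothSpace (x : smoothSpace T) :
    T ⟨x, smoothSpace_le_domain T x.2⟩ ∈ smoothSpace T := by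
  refine (Submodule.mem_iInf _).2 fun p => ?_
  obtain ⟨y, hy, hyx⟩ := (Submodule.mem_iInf _).1 x.2 (p + 1)
  have : (⟨x, smoothSpace_le_domain T x.2⟩ : T.domain) = y := Subtype.ext hyx.symm
  rw [this]
  exact hy

/-- The restriction `T : 𝔻 → 𝔻`. -/
def smoothMap : smoothSpace T →ₗ[ℝ] smoothSpace T :=
  (T.toFun ∘ₗ Submodule.inclusion (smoothSpace_le_domain T)).codRestrict (smoothSpace T)
    (map_mem_smoothSpace T)

end

/-! ### Generalized functions over `𝔻`

`𝒦 u` is a sum of powers of an unbounded operator applied to elements of `L²`. As for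
distributions, it is first computed in a larger space, the space `𝔻'` of linear forms on `𝔻`, which
contains `L²(0,1)` through `f ↦ ⟨f, ·⟩`, and to which the self-adjoint operator `𝓜` extends by
`(𝓜 τ)(φ) = τ(𝓜 φ)`. Then `D(𝒦)` consists of the `u ∈ L²` with `𝒦 u ∈ L²`. -/

section
variable {H : Type*} [NormedAddCommGroup H] [InnerProductSpace ℝ H] (T : H →ₗ.[ℝ] H)

/-- The space `𝔻'` of linear forms on `𝔻`. -/
abbrev GenFun : Type _ := Module.Dual ℝ (smoothSpace T)

/-- The map `H → 𝔻'`, `f ↦ ⟨f, ·⟩`. -/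
def toGenFun : H →ₗ[ℝ] GenFun T := (smoothSpace T).subtype.dualMap ∘ₗ innerₗ H

/-- The extension of (a symmetric operator) `T` to `𝔻'`: `(T τ)(φ) = τ(T φ)`. -/
def genMap : GenFun T →ₗ[ℝ] GenFun T := (smoothMap T).dualMap

/-- A real matrix acting on vectors with entries in a real vector space. -/
def matAct {ι ι' : Type*} [Fintype ι'] {V : Type*} [AddCommGroup V] [Module ℝ V]
    (C : Matrix ι ι' ℝ) : (ι' → V) →ₗ[ℝ] (ι → V) :=
  LinearMap.pi fun i => ∑ j, C i j • LinearMap.proj j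

/-- `T` acting componentwise on `(𝔻')ⁿ`. -/
def genMapVec (n : ℕ) : Module.End ℝ (Fin n → GenFun T) :=
  LinearMap.pi fun i => genMap T ∘ₗ LinearMap.proj i

/-- The operator `L = D T + A` on `(𝔻')ⁿ`. -/
def genL {n : ℕ} (D A : Matrix (Fin n) (Fin n) ℝ) : Module.End ℝ (Fin n → GenFun T) :=
  matAct D ∘ₗ genMapVec T n + matAct A

/-- `[L | B] = [L^(n-1) B | ⋯ | L B | B]` on `(𝔻')^(nm)`. The vector `u ∈ (𝔻')^(nm)` consists of
the blocks `u (0, ·), …, u (n-1, ·) ∈ (𝔻')^m`, and the `j`-th block (from `0`) of the operator is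
`L^(n-1-j) B`. -/
def genKalman {n m : ℕ} (D A : Matrix (Fin n) (Fin n) ℝ) (B : Matrix (Fin n) (Fin m) ℝ) :
    (Fin n × Fin m → GenFun T) →ₗ[ℝ] (Fin n → GenFun T) :=
  ∑ j : Fin n, (genL T D A ^ (n - 1 - (j : ℕ))) ∘ₗ matAct B ∘ₗ
    LinearMap.funLeft ℝ (GenFun T) (fun k => (j, k))

/-- The componentwise map `H^ι → (𝔻')^ι`. -/
def toGenFunVec (ι : Type) [Fintype ι] : PiLp 2 (fun _ : ι => H) →ₗ[ℝ] (ι → GenFun T) :=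
  (toGenFun T).compLeft ι ∘ₗ (WithLp.linearEquiv 2 ℝ (ι → H)).toLinearMap

/-- The graph of `𝒦`: pairs `(u, f)` of `L²`-vectors with `[L | B] u = f` in `(𝔻')ⁿ`. -/
def kalmanGraph {n m : ℕ} (D A : Matrix (Fin n) (Fin n) ℝ) (B : Matrix (Fin n) (Fin m) ℝ) :
    Submodule ℝ (PiLp 2 (fun _ : Fin n × Fin m => H) × PiLp 2 (fun _ : Fin n => H)) :=
  LinearMap.eqLocus
    (genKalman T D A B ∘ₗ toGenFunVec T (Fin n × Fin m) ∘ₗ LinearMap.fst ℝ _ _)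
    (toGenFunVec T (Fin n) ∘ₗ LinearMap.snd ℝ _ _)

end

/-- The Kalman operator `𝒦 = [L | B]`, `L = D 𝓜 + A`, from `D(𝒦) ⊆ L²(0,1)^(nm)` to `L²(0,1)ⁿ`,
with `D(𝒦) = {u ∈ L²(0,1)^(nm) : 𝒦 u ∈ L²(0,1)ⁿ}`. -/
def kalmanOp (κ : Degeneracy) (a : ℝ → ℝ) {n m : ℕ} (D A : Matrix (Fin n) (Fin n) ℝ)
    (B : Matrix (Fin n) (Fin m) ℝ) : L2Vec (Fin n × Fin m) →ₗ.[ℝ] L2Vec (Fin n) :=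
  (kalmanGraph (opM κ a) D A B).toLinearPMap

/-- The Kalman matrix `[L | B] = [L^(n-1) B | ⋯ | L B | B]` of an `n × n` matrix `L` and an
`n × m` matrix `B`. The column with index `(j, k)` is the `k`-th column of the `j`-th block
(from `0`) `L^(n-1-j) B`. -/
def kalmanMatrix {n m : ℕ} (L : Matrix (Fin n) (Fin n) ℝ) (B : Matrix (Fin n) (Fin m) ℝ) :
    Matrix (Fin n) (Fin n × Fin m) ℝ :=
  Matrix.of fun i jk => (L ^ (n - 1 - (jk.1 : ℕ)) * B) i jk.2

/-- `D` is diagonalizable with positive real eigenvalues: `D = P⁻¹ J P` with `P` an invertible real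
matrix and `J = diag(d₁, …, dₙ)`, all `dᵢ > 0`. -/
def IsPosDiagonalizable {n : ℕ} (D : Matrix (Fin n) (Fin n) ℝ) : Prop :=
  ∃ (P : Matrix (Fin n) (Fin n) ℝ) (d : Fin n → ℝ), P.det ≠ 0 ∧ (∀ i, 0 < d i) ∧
    D = P⁻¹ * Matrix.diagonal d * P

end DegenerateKalman

end

/-! The operator `-𝓜` has a compact, symmetric, injective inverse `G`, so the eigenvectors of `𝓜`
are total in `L²(0,1)`. If `-𝓜 e = λ_p e`, then `𝒦 (c ⊗ e) = (𝒦_p c) ⊗ e`, and testing any relation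
`𝒦 u = f` against `e` turns it into `𝒦_p` acting on the coefficients of `u` along `e`. Hence `y ∈
Ker 𝒦*` exactly when, for every `e`, the coefficient vector of `y` along `e` is a left null vector
of `𝒦_p`. A nonzero such `y` exists iff some `𝒦_p 𝒦_p*` is singular
(`pker_adjoint_kalman_eq_bot_iff`). Conditions 1 and 2 agree because `⟪𝒦𝒦* y, y⟫ = ‖𝒦* y‖²`
(`pker_pcomp_adjoint`).

The inverse comes from integrating `-(a u')' = f` once: `a u' = c - ∫₀ˣ f`. With `S f = a^(-1/2) ∫₀
f` and `Q` the projection that selects the constant `c`, one gets `G = R* R` for `R = Q S`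
(`exists_hasCompactInverseNeg`). Compactness is the Hilbert–Schmidt property of `S`, whose squared
norm is `∫ x / a(x) dx`, finite because `K < 2`. -/

namespace DegenerateKalman

/-! ### Abstract Kalman criterion for an operator with compact inverse -/

section Abstract

open Module End

variable {H : Type*} [NormedAddCommGroup H] [InnerProductSpace ℝ H]

theorem LinearPMap.exists_apply_of_mem_graph {E F : Type*} [AddCommGroup E] [Module ℝ E]
    [AddCommGroup F] [Module ℝ F] {T : E →ₗ.[ℝ] F} {x : E} {y : F} (h : (x, y) ∈ T.graph) :
    ∃ hx : x ∈ T.domain, T ⟨x, hx⟩ = y := by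
  obtain ⟨z, hz, hz'⟩ := (LinearPMap.mem_graph_iff T).1 h
  subst hz
  exact ⟨z.2, hz'⟩

/-- `G` is the inverse of `-T`, and it is compact, symmetric and injective. -/
structure HasCompactInverseNeg (T : H →ₗ.[ℝ] H) (G : H →L[ℝ] H) : Prop where
  compact : IsCompactOperator G
  symm : (G : H →ₗ[ℝ] H).IsSymmetric
  mem_graph : ∀ f, (G f, -f) ∈ T.graph
  eq_zero : ∀ u, (u, (0 : H)) ∈ T.graph → u = 0

namespace HasCompactInverseNeg

variable {T : H →ₗ.[ℝ] H} {G : H →L[ℝ] H}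

/-- Adding the graph elements `(x, T x)` and `(G (T x), -T x)` puts `x + G (T x)` in the kernel of
`T`. -/
theorem apply_eq (h : HasCompactInverseNeg T G) (x : T.domain) : G (T x) = -(x : H) := by
  have h1 := T.graph.add_mem (LinearPMap.mem_graph T x) (h.mem_graph (T x))
  have h2 := h.eq_zero (x + G (T x)) (by simpa using h1)
  exact eq_neg_of_add_eq_zero_right h2

theorem inner_apply (h : HasCompactInverseNeg T G) (x y : T.domain) :
    ⟪T x, (y : H)⟫_ℝ = ⟪(x : H), T y⟫_ℝ := by
  have := h.symm (T x) (T y)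
  simp only [ContinuousLinearMap.coe_coe, h.apply_eq, inner_neg_left, inner_neg_right] at this
  linarith

/-- By the spectral theorem the eigenspaces of `G` are total. The eigenvalue `0` does not occur, and
an eigenvalue `μ` of `G` is the eigenvalue `μ⁻¹` of `-T`. -/
theorem eq_zero_of_forall_inner [CompleteSpace H] (h : HasCompactInverseNeg T G) {x : H}
    (hx : ∀ (ev : ℝ) (e : T.domain), (e : H) ≠ 0 → -(T e) = ev • (e : H) → ⟪(e : H), x⟫_ℝ = 0) :
    x = 0 := by
  have key := ContinuousLinearMap.orthogonalComplement_iSup_eigenspaces_eq_bot h.compact h.symm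
  rw [← Submodule.mem_bot ℝ, ← key, Submodule.mem_orthogonal]
  intro u hu
  induction hu using Submodule.iSup_induction' with
  | mem μ e he =>
    by_cases he0 : e = 0
    · simp [he0]
    have hG : G e = μ • e := mem_eigenspace_iff.1 he
    have hμ : μ ≠ 0 := by
      rintro rfl
      have h1 := h.mem_graph e
      rw [hG, zero_smul] at h1
      exact he0 (neg_eq_zero.1 (T.graph_fst_eq_zero_snd h1 rfl))
    have h1 := T.graph.smul_mem μ⁻¹ (h.mem_graph e)
    rw [Prod.smul_mk, hG, smul_smul, inv_mul_cancel₀ hμ, one_smul] at h1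
    obtain ⟨h2, h3⟩ := LinearPMap.exists_apply_of_mem_graph h1
    exact hx μ⁻¹ ⟨e, h2⟩ he0 (by rw [h3]; simp)
  | zero => simp
  | add x y _ _ hx hy => rw [inner_add_left, hx, hy, add_zero]

end HasCompactInverseNeg

/-- A family indexed by `ι` whose components are multiples of one vector. -/
def tensorVec {ι V : Type*} [AddCommGroup V] [Module ℝ V] (σ : V) : (ι → ℝ) →ₗ[ℝ] (ι → V) :=
  LinearMap.pi fun i => (LinearMap.proj i).smulRight σ

theorem tensorVec_apply {ι V : Type*} [AddCommGroup V] [Module ℝ V] (σ : V) (c : ι → ℝ) (i : ι) :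
    tensorVec σ c i = c i • σ := rfl

theorem matAct_apply {ι ι' V : Type*} [Fintype ι'] [AddCommGroup V] [Module ℝ V]
    (C : Matrix ι ι' ℝ) (v : ι' → V) (i : ι) : matAct C v i = ∑ j, C i j • v j := by
  simp [matAct]

theorem matAct_tensorVec {ι ι' V : Type*} [Fintype ι'] [AddCommGroup V] [Module ℝ V]
    (C : Matrix ι ι' ℝ) (σ : V) (c : ι' → ℝ) :
    matAct C (tensorVec σ c) = tensorVec σ (C.mulVec c) := by
  ext i
  simp [matAct_apply, tensorVec_apply, Matrix.mulVec, dotProduct, Finset.sum_smul, smul_smul]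

theorem kalmanMatrix_mulVec {n m : ℕ} (L : Matrix (Fin n) (Fin n) ℝ) (B : Matrix (Fin n) (Fin m) ℝ)
    (c : Fin n × Fin m → ℝ) :
    (kalmanMatrix L B).mulVec c =
      ∑ j : Fin n, (L ^ (n - 1 - (j : ℕ))).mulVec (B.mulVec fun k => c (j, k)) := by
  ext i
  simp only [Matrix.mulVec_mulVec, Finset.sum_apply]
  simp [Matrix.mulVec, dotProduct, kalmanMatrix, Fintype.sum_prod_type]

/-! ### The generalized Kalman operator on eigenvectors -/

section Eigen

variable {T : H →ₗ.[ℝ] H} {n m : ℕ} (D A : Matrix (Fin n) (Fin n) ℝ) (B : Matrix (Fin n) (Fin m) ℝ)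

/-- Eigenvectors are thereby admissible test vectors for `GenFun T`. -/
theorem mem_smoothSpace_of_eigen {ev : ℝ} {e : T.domain} (he : -(T e) = ev • (e : H)) :
    (e : H) ∈ smoothSpace T := by
  refine (Submodule.mem_iInf _).2 fun p => ?_
  induction p with
  | zero => trivial
  | succ p ih =>
    refine ⟨e, ?_, rfl⟩
    change T e ∈ powDomain T p
    rw [← neg_neg (T e), he]
    exact neg_mem (Submodule.smul_mem _ _ ih)

theorem smoothMap_of_eigen {ev : ℝ} {e : T.domain} (he : -(T e) = ev • (e : H)) :
    smoothMap T ⟨e, mem_smoothSpace_of_eigen he⟩ = -ev • ⟨e, mem_smoothSpace_of_eigen he⟩ := by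
  apply Subtype.ext
  change T e = -ev • (e : H)
  rw [neg_smul, ← he, neg_neg]

section Test

variable {e : smoothSpace T} {ev : ℝ} (he : smoothMap T e = -ev • e)
include he

theorem genL_apply_eigen (τ : Fin n → GenFun T) :
    (fun i => genL T D A τ i e) = (-(ev • D) + A).mulVec fun i => τ i e := by
  have h1 : ∀ σ : GenFun T, genMap T σ e = -ev * σ e := by
    intro σ
    change σ (smoothMap T e) = _
    rw [he, map_smul, smul_eq_mul]
  ext i
  simp [genL, genMapVec, matAct_apply, h1, Matrix.mulVec, dotProduct, add_mul,
    Finset.sum_add_distrib]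
  refine Finset.sum_congr rfl fun j _ => by ring

theorem genL_pow_apply_eigen (p : ℕ) (τ : Fin n → GenFun T) :
    (fun i => (genL T D A ^ p) τ i e) = ((-(ev • D) + A) ^ p).mulVec fun i => τ i e := by
  induction p with
  | zero => simp
  | succ p ih =>
    rw [pow_succ', Module.End.mul_apply, genL_apply_eigen D A he, ih, pow_succ',
      Matrix.mulVec_mulVec]

theorem genKalman_apply_eigen (τ : Fin n × Fin m → GenFun T) :
    (fun i => genKalman T D A B τ i e) =
      (kalmanMatrix (-(ev • D) + A) B).mulVec fun i => τ i e := by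
  rw [kalmanMatrix_mulVec]
  have h : ∀ j : Fin n, (fun i => (genL T D A ^ (n - 1 - (j : ℕ)))
      (matAct B (LinearMap.funLeft ℝ (GenFun T) (fun k => (j, k)) τ)) i e) =
      ((-(ev • D) + A) ^ (n - 1 - (j : ℕ))).mulVec (B.mulVec fun k => τ (j, k) e) := by
    intro j
    rw [genL_pow_apply_eigen D A he]
    congr 1
    ext i
    simp [matAct_apply, Matrix.mulVec, dotProduct, LinearMap.funLeft]
  simp only [← h]
  ext i
  simp [genKalman]

end Test

section Tensor

variable {σ : GenFun T} {ev : ℝ} (hσ : genMap T σ = -ev • σ)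
include hσ

theorem genL_tensorVec (c : Fin n → ℝ) :
    genL T D A (tensorVec σ c) = tensorVec σ ((-(ev • D) + A).mulVec c) := by
  have h1 : genMapVec T n (tensorVec σ c) = -ev • tensorVec σ c := by
    refine funext fun i => ?_
    simp only [genMapVec, LinearMap.pi_apply, LinearMap.comp_apply, LinearMap.proj_apply,
      tensorVec_apply, map_smul, hσ, Pi.smul_apply]
    rw [smul_comm]
  rw [genL, LinearMap.add_apply, LinearMap.comp_apply, h1, map_smul, matAct_tensorVec,
    matAct_tensorVec, ← map_smul, ← map_add, Matrix.add_mulVec, Matrix.neg_mulVec,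
    Matrix.smul_mulVec, neg_smul]

theorem genL_pow_tensorVec (p : ℕ) (c : Fin n → ℝ) :
    (genL T D A ^ p) (tensorVec σ c) = tensorVec σ (((-(ev • D) + A) ^ p).mulVec c) := by
  induction p with
  | zero => simp
  | succ p ih =>
    rw [pow_succ', Module.End.mul_apply, ih, genL_tensorVec D A hσ, pow_succ',
      Matrix.mulVec_mulVec]

theorem genKalman_tensorVec (c : Fin n × Fin m → ℝ) :
    genKalman T D A B (tensorVec σ c) =
      tensorVec σ ((kalmanMatrix (-(ev • D) + A) B).mulVec c) := by
  rw [kalmanMatrix_mulVec, map_sum, genKalman, LinearMap.sum_apply]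
  refine Finset.sum_congr rfl fun j _ => ?_
  have h : LinearMap.funLeft ℝ (GenFun T) (fun k : Fin m => (j, k)) (tensorVec σ c) =
      tensorVec σ fun k => c (j, k) := rfl
  rw [LinearMap.comp_apply, LinearMap.comp_apply, h, matAct_tensorVec, genL_pow_tensorVec D A hσ]

end Tensor

end Eigen

/-- The vector `c ⊗ e` of `H^ι`. -/
def tensorPi {ι : Type} [Fintype ι] (c : ι → ℝ) (e : H) : PiLp 2 (fun _ : ι => H) :=
  WithLp.toLp 2 (tensorVec e c)

theorem tensorPi_apply {ι : Type} [Fintype ι] (c : ι → ℝ) (e : H) (i : ι) :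
    tensorPi c e i = c i • e := rfl

theorem toGenFunVec_tensorPi (T : H →ₗ.[ℝ] H) {ι : Type} [Fintype ι] (c : ι → ℝ) (e : H) :
    toGenFunVec T ι (tensorPi c e) = tensorVec (toGenFun T e) c := by
  refine funext fun i => ?_
  change toGenFun T (c i • e) = c i • toGenFun T e
  exact map_smul _ _ _

theorem inner_tensorPi {ι : Type} [Fintype ι] (x : PiLp 2 (fun _ : ι => H)) (c : ι → ℝ) (e : H) :
    ⟪x, tensorPi c e⟫_ℝ = (fun i => ⟪x i, e⟫_ℝ) ⬝ᵥ c := by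
  simp [PiLp.inner_apply, tensorPi_apply, inner_smul_right, dotProduct, mul_comm]

/-! ### Kernel of the adjoint Kalman operator -/

section Kalman

variable [CompleteSpace H] {T : H →ₗ.[ℝ] H} {G : H →L[ℝ] H}

theorem HasCompactInverseNeg.eq_zero_of_forall_inner_tensorPi (h : HasCompactInverseNeg T G)
    {ι : Type} [Fintype ι] {x : PiLp 2 (fun _ : ι => H)}
    (hx : ∀ (ev : ℝ) (e : T.domain), -(T e) = ev • (e : H) → ∀ c : ι → ℝ,
      ⟪x, tensorPi c (e : H)⟫_ℝ = 0) : x = 0 := by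
  classical
  refine PiLp.ext fun i => h.eq_zero_of_forall_inner fun ev e _ he => ?_
  have := hx ev e he (Pi.single i 1)
  rwa [inner_tensorPi, dotProduct_single, mul_one, real_inner_comm] at this

variable {n m : ℕ} {D A : Matrix (Fin n) (Fin n) ℝ} {B : Matrix (Fin n) (Fin m) ℝ}

omit [CompleteSpace H] in
-- Symmetry of `T` makes the form `⟪e, ·⟫` an eigenvector of the extension `genMap T`. This supplies
-- enough elements of the graph for density and for the kernel computation.
theorem mem_kalmanGraph_tensorPi (h : HasCompactInverseNeg T G) {ev : ℝ} {e : T.domain}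
    (he : -(T e) = ev • (e : H)) (c : Fin n × Fin m → ℝ) :
    (tensorPi c (e : H), tensorPi ((kalmanMatrix (-(ev • D) + A) B).mulVec c) (e : H)) ∈
      kalmanGraph T D A B := by
  have hσ : genMap T (toGenFun T e) = -ev • toGenFun T e := by
    ext φ
    change ⟪(e : H), T ⟨φ, smoothSpace_le_domain T φ.2⟩⟫_ℝ = -ev * ⟪(e : H), φ⟫_ℝ
    rw [← h.inner_apply, ← neg_neg (T e), he, inner_neg_left, real_inner_smul_left, neg_mul]
  change genKalman T D A B (toGenFunVec T _ (tensorPi c (e : H))) =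
    toGenFunVec T _ (tensorPi ((kalmanMatrix (-(ev • D) + A) B).mulVec c) (e : H))
  rw [toGenFunVec_tensorPi, toGenFunVec_tensorPi, genKalman_tensorVec D A B hσ]

omit [CompleteSpace H] in
theorem kalmanMatrix_mulVec_of_mem_kalmanGraph {u : PiLp 2 (fun _ : Fin n × Fin m => H)}
    {f : PiLp 2 (fun _ : Fin n => H)} (huf : (u, f) ∈ kalmanGraph T D A B) {ev : ℝ} {e : T.domain}
    (he : -(T e) = ev • (e : H)) :
    (kalmanMatrix (-(ev • D) + A) B).mulVec (fun i => ⟪u i, (e : H)⟫_ℝ) =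
      fun i => ⟪f i, (e : H)⟫_ℝ := by
  have h1 : genKalman T D A B (toGenFunVec T _ u) = toGenFunVec T _ f := huf
  have h2 := genKalman_apply_eigen D A B (smoothMap_of_eigen he) (toGenFunVec T _ u)
  rw [h1] at h2
  exact h2.symm

/-- Single-valuedness is what makes the graph of `toLinearPMap` equal to `kalmanGraph`. -/
theorem kalmanGraph_snd_eq_zero (h : HasCompactInverseNeg T G)
    (p) (hp : p ∈ kalmanGraph T D A B) (hp0 : p.1 = 0) : p.2 = 0 := by
  obtain ⟨u, f⟩ := p
  obtain rfl : u = 0 := hp0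
  refine h.eq_zero_of_forall_inner_tensorPi fun ev e he c => ?_
  have := kalmanMatrix_mulVec_of_mem_kalmanGraph hp he
  rw [inner_tensorPi, ← this]
  have h0 : (fun i => ⟪(0 : PiLp 2 (fun _ : Fin n × Fin m => H)) i, (e : H)⟫_ℝ) = 0 := by
    ext i; simp
  rw [h0, Matrix.mulVec_zero, zero_dotProduct]

/-- The domain contains every `c ⊗ e` with `e` an eigenvector. Density is needed for
`LinearPMap.adjoint` to be the true adjoint rather than its default value. -/
theorem dense_domain_kalman (h : HasCompactInverseNeg T G) :
    Dense ((kalmanGraph T D A B).toLinearPMap.domain :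
      Set (PiLp 2 (fun _ : Fin n × Fin m => H))) := by
  rw [Submodule.dense_iff_topologicalClosure_eq_top, Submodule.topologicalClosure_eq_top_iff,
    Submodule.eq_bot_iff]
  intro x hx
  refine h.eq_zero_of_forall_inner_tensorPi fun ev e he c => ?_
  exact (Submodule.mem_orthogonal' _ _).1 hx _
    ⟨_, mem_kalmanGraph_tensorPi h he c, rfl⟩

theorem mem_pker {E F : Type*} [AddCommGroup E] [Module ℝ E] [AddCommGroup F] [Module ℝ F]
    {T : E →ₗ.[ℝ] F} {x : E} : x ∈ pker T ↔ ∃ hx : x ∈ T.domain, T ⟨x, hx⟩ = 0 := by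
  constructor
  · rintro ⟨y, hy, rfl⟩
    exact ⟨y.2, hy⟩
  · rintro ⟨hx, h⟩
    exact ⟨⟨x, hx⟩, h, rfl⟩

/-- If `S S* y = 0`, then `‖S* y‖² = ⟪y, S S* y⟫ = 0`. -/
theorem pker_pcomp_adjoint {E F : Type*} [NormedAddCommGroup E] [InnerProductSpace ℝ E]
    [CompleteSpace E] [NormedAddCommGroup F] [InnerProductSpace ℝ F] {S : E →ₗ.[ℝ] F}
    (hS : Dense (S.domain : Set E)) : pker (pcomp S S.adjoint) = pker S.adjoint := by
  ext x
  rw [mem_pker, mem_pker]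
  constructor
  · rintro ⟨hx, h⟩
    obtain ⟨y, hy, rfl⟩ := hx
    have h0 : S ⟨S.adjoint y, hy⟩ = 0 := h
    refine ⟨y.2, ?_⟩
    have := LinearPMap.adjoint_isFormalAdjoint hS y ⟨S.adjoint y, hy⟩
    rw [h0, inner_zero_right] at this
    exact inner_self_eq_zero.1 this
  · rintro ⟨hx, h⟩
    have hmem : S.adjoint ⟨x, hx⟩ ∈ S.domain := by rw [h]; exact zero_mem _
    refine ⟨⟨⟨x, hx⟩, hmem, rfl⟩, ?_⟩
    change S ⟨S.adjoint ⟨x, hx⟩, hmem⟩ = 0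
    have : (⟨S.adjoint ⟨x, hx⟩, hmem⟩ : S.domain) = 0 := Subtype.ext h
    rw [this, LinearPMap.map_zero]

theorem mem_pker_adjoint {E F : Type*} [NormedAddCommGroup E] [InnerProductSpace ℝ E]
    [CompleteSpace E] [NormedAddCommGroup F] [InnerProductSpace ℝ F] {S : E →ₗ.[ℝ] F}
    (hS : Dense (S.domain : Set E)) {y : F} :
    y ∈ pker S.adjoint ↔ ∀ x : S.domain, ⟪y, S x⟫_ℝ = 0 := by
  rw [mem_pker]
  constructor
  · rintro ⟨hy, h⟩ x
    rw [← LinearPMap.adjoint_isFormalAdjoint hS ⟨y, hy⟩ x, h, inner_zero_left]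
  · intro h
    refine ⟨LinearPMap.mem_adjoint_domain_of_exists y ⟨0, fun x => ?_⟩,
      LinearPMap.adjoint_apply_eq hS _ fun x => ?_⟩
    all_goals rw [inner_zero_left, h]

theorem mem_pker_adjoint_kalman (h : HasCompactInverseNeg T G) {y : PiLp 2 (fun _ : Fin n => H)} :
    y ∈ pker (kalmanGraph T D A B).toLinearPMap.adjoint ↔
      ∀ u f, (u, f) ∈ kalmanGraph T D A B → ⟪y, f⟫_ℝ = 0 := by
  rw [mem_pker_adjoint (dense_domain_kalman h)]
  have hg := Submodule.toLinearPMap_graph_eq _ (kalmanGraph_snd_eq_zero (D := D) (A := A) (B := B) h)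
  constructor
  · intro hy u f huf
    rw [← hg] at huf
    obtain ⟨hu, rfl⟩ := LinearPMap.exists_apply_of_mem_graph huf
    exact hy _
  · intro hy x
    have hx := LinearPMap.mem_graph _ x
    rw [hg] at hx
    exact hy x _ hx

/-- A left null vector `v` of `C Cᵀ` satisfies `|v C|² = v C Cᵀ vᵀ = 0`. -/
theorem exists_ne_zero_vecMul_of_det_mul_transpose_eq_zero {ι ι' : Type*} [Fintype ι]
    [DecidableEq ι] [Fintype ι'] {C : Matrix ι ι' ℝ} (hC : (C * C.transpose).det = 0) :
    ∃ v ≠ 0, Matrix.vecMul v C = 0 := by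
  obtain ⟨v, hv, hv0⟩ := Matrix.exists_vecMul_eq_zero_iff.2 hC
  refine ⟨v, hv, ?_⟩
  rw [← dotProduct_self_eq_zero]
  nth_rewrite 2 [← Matrix.mulVec_transpose]
  rw [Matrix.dotProduct_mulVec, Matrix.vecMul_vecMul, hv0, zero_dotProduct]

theorem HasCompactInverseNeg.pker_adjoint_kalman_eq_bot_iff (h : HasCompactInverseNeg T G) :
    pker (kalmanGraph T D A B).toLinearPMap.adjoint = ⊥ ↔
      ∀ ev : ℝ, IsEigenvalueNeg T ev → (kalmanMatrix (-(ev • D) + A) B *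
        (kalmanMatrix (-(ev • D) + A) B).transpose).det ≠ 0 := by
  constructor
  · rintro hker ev ⟨e, he0, he⟩ hdet
    obtain ⟨v, hv0, hv⟩ := exists_ne_zero_vecMul_of_det_mul_transpose_eq_zero hdet
    -- A left null vector `v` of the Kalman matrix yields the nonzero kernel element `v ⊗ e`.
    have hmem : tensorPi v (e : H) ∈ pker (kalmanGraph T D A B).toLinearPMap.adjoint := by
      rw [mem_pker_adjoint_kalman h]
      intro u f huf
      rw [real_inner_comm, inner_tensorPi, ← kalmanMatrix_mulVec_of_mem_kalmanGraph huf he,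
        dotProduct_comm, Matrix.dotProduct_mulVec, hv, zero_dotProduct]
    rw [hker, Submodule.mem_bot] at hmem
    apply hv0
    ext i
    have : v i • (e : H) = 0 := congrArg (fun x : PiLp 2 (fun _ : Fin n => H) => x i) hmem
    exact (smul_eq_zero.1 this).resolve_right he0
  · intro hdet
    rw [Submodule.eq_bot_iff]
    intro y hy
    rw [mem_pker_adjoint_kalman h] at hy
    refine h.eq_zero_of_forall_inner_tensorPi fun ev e he c => ?_
    by_cases he0 : (e : H) = 0
    · rw [inner_tensorPi, he0]; simp
    set K := kalmanMatrix (-(ev • D) + A) B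
    -- Orthogonality of `y` to each `(K c) ⊗ e` says that its coefficients along `e` annihilate `K`
    -- from the left.
    have hK : Matrix.vecMul (fun i => ⟪y i, (e : H)⟫_ℝ) K = 0 := by
      refine dotProduct_eq_zero _ fun c => ?_
      rw [← Matrix.dotProduct_mulVec, ← inner_tensorPi]
      exact hy _ _ (mem_kalmanGraph_tensorPi h he c)
    have hv : (fun i => ⟪y i, (e : H)⟫_ℝ) = 0 := by
      by_contra hv
      refine hdet ev ⟨e, he0, he⟩ (Matrix.exists_vecMul_eq_zero_iff.1 ⟨_, hv, ?_⟩)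
      rw [← Matrix.vecMul_vecMul, hK, Matrix.zero_vecMul]
    rw [inner_tensorPi, hv, zero_dotProduct]

theorem HasCompactInverseNeg.kalman_tfae (h : HasCompactInverseNeg T G) :
    List.TFAE [
      pker (kalmanGraph T D A B).toLinearPMap.adjoint = ⊥,
      pker (pcomp (kalmanGraph T D A B).toLinearPMap
        (kalmanGraph T D A B).toLinearPMap.adjoint) = ⊥,
      ∀ ev : ℝ, IsEigenvalueNeg T ev → (kalmanMatrix (-(ev • D) + A) B *
        (kalmanMatrix (-(ev • D) + A) B).transpose).det ≠ 0] := by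
  rw [pker_pcomp_adjoint (dense_domain_kalman h)]
  tfae_have 1 ↔ 3 := h.pker_adjoint_kalman_eq_bot_iff
  tfae_have 1 ↔ 2 := Iff.rfl
  tfae_finish

end Kalman

end Abstract

/-! ### Compactness of Hilbert–Schmidt kernels -/

section HilbertSchmidt

variable {α E : Type*} [MeasurableSpace α] {μ : Measure α} [NormedAddCommGroup E]
  [InnerProductSpace ℝ E]

variable (μ E) in
/-- The integral operator `f ↦ (y ↦ ⟪f, k y⟫)` with kernel `k ∈ L²(μ; E)`, as a function
of `k`. -/
noncomputable def kernelOp : Lp E 2 μ →L[ℝ] E →L[ℝ] Lp ℝ 2 μ :=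
  (ContinuousLinearMap.compLpL₂ 2 μ (innerSL ℝ)).flip

theorem coeFn_kernelOp (k : Lp E 2 μ) (f : E) : kernelOp E μ k f =ᵐ[μ] fun y => ⟪f, k y⟫_ℝ :=
  (innerSL ℝ f).coeFn_compLp k

/-- An indicator kernel gives an operator of rank at most one, simple kernels are dense, and compact
operators form a closed set whose preimage under the continuous map `k ↦ kernelOp E μ k` is closed.
-/
theorem isCompactOperator_kernelOp (k : Lp E 2 μ) : IsCompactOperator (kernelOp E μ k) := by
  induction k using Lp.induction (p := 2) ENNReal.ofNat_ne_top with
  | @indicatorConst c s hs hμs =>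
    have : kernelOp E μ (Lp.simpleFunc.indicatorConst 2 hs hμs.ne c : Lp E 2 μ) =
        (ContinuousLinearMap.toSpanSingleton ℝ (indicatorConstLp 2 hs hμs.ne (1 : ℝ))) ∘L
          (innerSL ℝ c) := by
      ext1 f
      rw [Lp.simpleFunc.coe_indicatorConst]
      apply Lp.ext
      refine (coeFn_kernelOp _ f).trans ?_
      rw [ContinuousLinearMap.comp_apply, ContinuousLinearMap.toSpanSingleton_apply]
      filter_upwards [indicatorConstLp_coeFn (p := 2) (hs := hs) (hμs := hμs.ne) (c := c),
        indicatorConstLp_coeFn (p := 2) (hs := hs) (hμs := hμs.ne) (c := (1 : ℝ)),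
        Lp.coeFn_smul (innerSL ℝ c f) (indicatorConstLp 2 hs hμs.ne (1 : ℝ))] with x h1 h2 h3
      rw [h1, h3, Pi.smul_apply, h2]
      by_cases hx : x ∈ s
      · simp [indicator_of_mem hx, real_inner_comm]
      · simp [indicator_of_notMem hx]
    rw [this]
    exact (isCompactOperator_of_locallyCompactSpace_rng
      (ContinuousLinearMap.toSpanSingleton ℝ _)).comp_clm _
  | add hf hg _ h1 h2 => rw [map_add]; exact h1.add h2
  | isClosed =>
    exact isClosed_setOfPred_isCompactOperator.preimage (kernelOp E μ).continuous

end HilbertSchmidt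

/-! ### Growth of the coefficient at the degenerate point -/

section Coefficient

variable {a : ℝ → ℝ}

theorem Degeneracy.Holds.pos {κ : Degeneracy} (h : κ.Holds a) : ∀ x ∈ Ioc (0 : ℝ) 1, 0 < a x := by
  cases κ with
  | weak => exact h.2.2.1
  | strong => exact h.2.1

theorem Degeneracy.Holds.contDiffOn {κ : Degeneracy} (h : κ.Holds a) :
    ContDiffOn ℝ 1 a (Ioc 0 1) := by
  cases κ with
  | weak => exact h.2.1
  | strong => exact h.1.mono Ioc_subset_Icc_self

/-- The inequality `x a' ≤ K a` says that `a(x) x^(-K)` is nonincreasing; compare its values at `x`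
and `1`. -/
theorem apply_one_mul_rpow_le (ha : ContDiffOn ℝ 1 a (Ioc 0 1)) {K : ℝ}
    (hK : ∀ x ∈ Ioc (0 : ℝ) 1, x * derivWithin a (Icc 0 1) x ≤ K * a x) :
    ∀ x ∈ Ioc (0 : ℝ) 1, a 1 * x ^ K ≤ a x := by
  have hd : ∀ x ∈ Ioo (0 : ℝ) 1, HasDerivAt a (derivWithin a (Icc 0 1) x) x := by
    intro x hx
    rw [derivWithin_of_mem_nhds (Icc_mem_nhds hx.1 hx.2)]
    exact ((ha.differentiableOn one_ne_zero).differentiableAt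
      (Ioc_mem_nhds hx.1 hx.2)).hasDerivAt
  have hf : ∀ x ∈ Ioo (0 : ℝ) 1, HasDerivAt (fun x => a x * x ^ (-K))
      (derivWithin a (Icc 0 1) x * x ^ (-K) + a x * (-K * x ^ (-K - 1))) x := fun x hx =>
    (hd x hx).mul (Real.hasDerivAt_rpow_const (Or.inl hx.1.ne'))
  have hanti : AntitoneOn (fun x => a x * x ^ (-K)) (Ioc 0 1) := by
    refine antitoneOn_of_deriv_nonpos (convex_Ioc 0 1) ?_ ?_ ?_
    · exact ha.continuousOn.mul fun x hx =>
        (Real.continuousAt_rpow_const _ _ (Or.inl hx.1.ne')).continuousWithinAt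
    · rw [interior_Ioc]
      exact fun x hx => (hf x hx).differentiableAt.differentiableWithinAt
    · rw [interior_Ioc]
      intro x hx
      rw [(hf x hx).deriv]
      have h1 : x ^ (-K) = x * x ^ (-K - 1) := by
        rw [Real.rpow_sub_one hx.1.ne', mul_div_cancel₀ _ hx.1.ne']
      rw [h1]
      have h2 : 0 < x ^ (-K - 1) := Real.rpow_pos_of_pos hx.1 _
      have h3 := hK x (Ioo_subset_Ioc_self hx)
      nlinarith
  intro x hx
  have h1 : a 1 * 1 ^ (-K) ≤ a x * x ^ (-K) := hanti hx (right_mem_Ioc.2 one_pos) hx.2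
  rw [Real.one_rpow, mul_one, Real.rpow_neg hx.1.le] at h1
  have h2 : 0 < x ^ K := Real.rpow_pos_of_pos hx.1 _
  rwa [← div_eq_mul_inv, le_div_iff₀ h2] at h1

theorem continuousOn_inv_sqrt (ha : ContinuousOn a (Ioc 0 1)) (hpos : ∀ x ∈ Ioc (0 : ℝ) 1, 0 < a x) :
    ContinuousOn (fun x => (√(a x))⁻¹) (Ioc 0 1) :=
  ha.sqrt.inv₀ fun x hx => (Real.sqrt_pos.2 (hpos x hx)).ne'

theorem integrable_rpow_div (ha : ContinuousOn a (Ioc 0 1))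
    (hpos : ∀ x ∈ Ioc (0 : ℝ) 1, 0 < a x) {K : ℝ}
    (hK : ∀ x ∈ Ioc (0 : ℝ) 1, a 1 * x ^ K ≤ a x) {s : ℝ} (hs : -1 < s - K) :
    Integrable (fun x => x ^ s / a x) μ01 := by
  have h1 : 0 < a 1 := hpos 1 (right_mem_Ioc.2 one_pos)
  have hi : Integrable (fun x => (a 1)⁻¹ * x ^ (s - K)) μ01 :=
    (((intervalIntegral.integrableOn_Ioo_rpow_iff one_pos).2 hs).integrable).const_mul _
  refine hi.mono' ?_ ?_
  · refine ContinuousOn.aestronglyMeasurable (fun x hx => ?_) measurableSet_Ioo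
    exact (Real.continuousAt_rpow_const _ _ (Or.inl hx.1.ne')).continuousWithinAt.div
      ((ha x (Ioo_subset_Ioc_self hx)).mono Ioo_subset_Ioc_self)
      (hpos x (Ioo_subset_Ioc_self hx)).ne'
  · filter_upwards [ae_restrict_mem measurableSet_Ioo] with x hx
    have hx' := Ioo_subset_Ioc_self hx
    have h2 : 0 < x ^ s := Real.rpow_pos_of_pos hx.1 _
    have h3 : 0 < x ^ K := Real.rpow_pos_of_pos hx.1 _
    rw [Real.norm_of_nonneg (div_nonneg h2.le (hpos x hx').le), Real.rpow_sub hx.1,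
      inv_mul_eq_div, div_div, mul_comm]
    exact div_le_div_of_nonneg_left h2.le (mul_pos h1 h3) (hK x hx')

theorem Degeneracy.Holds.integrable_self_div {κ : Degeneracy} (h : κ.Holds a) :
    Integrable (fun x => x / a x) μ01 := by
  obtain ⟨K, hK2, hK⟩ : ∃ K < 2, ∀ x ∈ Ioc (0 : ℝ) 1, x * derivWithin a (Icc 0 1) x ≤ K * a x := by
    cases κ with
    | weak =>
      obtain ⟨K, hK1, hK⟩ := h.2.2.2.2
      exact ⟨K, hK1.2.trans one_lt_two, hK⟩
    | strong =>
      obtain ⟨K, hK1, hK, -⟩ := h.2.2.2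
      exact ⟨K, hK1.2, fun x hx => hK x (Ioc_subset_Icc_self hx)⟩
  simpa using integrable_rpow_div h.contDiffOn.continuousOn h.pos
    (apply_one_mul_rpow_le h.contDiffOn hK) (s := 1) (by linarith)

theorem WeaklyDegenerate.integrable_inv (h : WeaklyDegenerate a) :
    Integrable (fun x => (a x)⁻¹) μ01 := by
  obtain ⟨K, hK1, hK⟩ := h.2.2.2.2
  simpa using integrable_rpow_div h.2.1.continuousOn h.2.2.1
    (apply_one_mul_rpow_le h.2.1 hK) (s := 0) (by linarith [hK1.2])

/-- Since `a` is `C¹` up to `0` and vanishes there, `a x ≤ C x`, so `1/a` dominates a multiple of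
`1/x`. -/
theorem StronglyDegenerate.not_integrable_inv (h : StronglyDegenerate a) :
    ¬ Integrable (fun x => (a x)⁻¹) μ01 := by
  intro hi
  obtain ⟨C, hC⟩ := h.1.exists_lipschitzOnWith one_ne_zero (convex_Icc 0 1) isCompact_Icc
  have hbd : ∀ x ∈ Ioc (0 : ℝ) 1, a x ≤ C * x := by
    intro x hx
    have := hC.dist_le_mul x (Ioc_subset_Icc_self hx) 0 (left_mem_Icc.2 zero_le_one)
    rw [h.2.2.1, Real.dist_eq, Real.dist_eq, sub_zero, sub_zero, abs_of_pos hx.1] at this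
    exact (le_abs_self _).trans this
  have hx : Integrable (fun x : ℝ => x ^ (-1 : ℝ)) μ01 := by
    refine (hi.const_mul (C : ℝ)).mono' ?_ ?_
    · refine ContinuousOn.aestronglyMeasurable (fun x hx => ?_) measurableSet_Ioo
      exact (Real.continuousAt_rpow_const _ _ (Or.inl hx.1.ne')).continuousWithinAt
    · filter_upwards [ae_restrict_mem measurableSet_Ioo] with x hx
      have hx' := Ioo_subset_Ioc_self hx
      have h1 := h.2.1 x hx'
      rw [Real.norm_of_nonneg (Real.rpow_nonneg hx.1.le _), Real.rpow_neg_one, ← div_eq_mul_inv,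
        le_div_iff₀ h1, inv_mul_le_iff₀ hx.1, mul_comm]
      exact hbd x hx'
  exact lt_irrefl _ ((intervalIntegral.integrableOn_Ioo_rpow_iff one_pos).1 hx)

end Coefficient

/-! ### The weighted primitive and its adjoint -/

section Primitive

open Topology Filter

variable {a : ℝ → ℝ}

theorem L2.intervalIntegrable (f : L2) : IntervalIntegrable f volume 0 1 := by
  rw [intervalIntegrable_iff_integrableOn_Ioo_of_le zero_le_one]
  exact (Lp.memLp f).integrable one_le_two

theorem intervalIntegrable_inv_sqrt_mul (ha : ContinuousOn a (Ioc 0 1))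
    (hpos : ∀ x ∈ Ioc (0 : ℝ) 1, 0 < a x) (h : L2) {δ : ℝ} (hδ : δ ∈ Ioc (0 : ℝ) 1) :
    IntervalIntegrable (fun y => (√(a y))⁻¹ * h y) volume δ 1 := by
  have hsub : uIcc δ 1 ⊆ uIcc 0 1 := by
    rw [uIcc_of_le hδ.2, uIcc_of_le zero_le_one]
    exact Icc_subset_Icc_left hδ.1.le
  refine (h.intervalIntegrable.mono_set hsub).continuousOn_mul
    ((continuousOn_inv_sqrt ha hpos).mono ?_)
  rw [uIcc_of_le hδ.2]
  exact fun x hx => ⟨hδ.1.trans_le hx.1, hx.2⟩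

/-- This gives the measurability of the `L²`-valued kernel of the weighted primitive. -/
theorem continuous_indicatorConstLp_Ioc :
    Continuous fun y : ℝ => indicatorConstLp (μ := μ01) 2 (measurableSet_Ioc (a := (0 : ℝ)) (b := y))
      (measure_ne_top _ _) (1 : ℝ) := by
  refine continuous_indicatorConstLp_set ENNReal.ofNat_ne_top fun x => ?_
  have hle : ∀ y, μ01 (symmDiff (Ioc 0 y) (Ioc 0 x)) ≤ ENNReal.ofReal |y - x| := by
    intro y
    refine (Measure.restrict_apply_le _ _).trans ?_
    rw [← Real.volume_interval (a := x) (b := y)]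
    refine measure_mono fun z hz => ?_
    rw [mem_uIcc]
    rcases hz with ⟨h1, h2⟩ | ⟨h1, h2⟩
    · exact Or.inl ⟨le_of_not_ge fun h => h2 ⟨h1.1, h⟩, h1.2⟩
    · exact Or.inr ⟨le_of_not_ge fun h => h2 ⟨h1.1, h⟩, h1.2⟩
  refine tendsto_of_tendsto_of_tendsto_of_le_of_le tendsto_const_nhds ?_ (fun _ => bot_le) hle
  have : Tendsto (fun y => ENNReal.ofReal |y - x|) (𝓝 x) (𝓝 (ENNReal.ofReal |x - x|)) :=
    ENNReal.tendsto_ofReal (by fun_prop : Continuous fun y : ℝ => |y - x|).continuousAt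
  simpa using this

theorem inner_indicatorConstLp_Ioc (f : L2) {y : ℝ} (hy : y ∈ Ioo (0 : ℝ) 1) :
    ⟪f, indicatorConstLp (μ := μ01) 2 (measurableSet_Ioc (a := (0 : ℝ)) (b := y))
      (measure_ne_top _ _) (1 : ℝ)⟫_ℝ = ∫ x in 0..y, f x := by
  rw [real_inner_comm, L2.inner_indicatorConstLp_one, intervalIntegral.integral_of_le hy.1.le,
    Measure.restrict_restrict measurableSet_Ioc, inter_eq_left.2]
  exact fun x hx => ⟨hx.1, hx.2.trans_lt hy.2⟩

/-- The weighted primitive `f ↦ a^(-1/2) ∫₀ f` is a compact operator on `L²(0,1)`. -/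
theorem exists_weightedPrimitive (ha : ContinuousOn a (Ioc 0 1))
    (hpos : ∀ x ∈ Ioc (0 : ℝ) 1, 0 < a x) (hint : Integrable (fun x => x / a x) μ01) :
    ∃ S : L2 →L[ℝ] L2, IsCompactOperator S ∧
      ∀ f : L2, S f =ᵐ[μ01] fun y => (√(a y))⁻¹ * ∫ x in 0..y, f x := by
  have hk : MemLp (fun y => (√(a y))⁻¹ • indicatorConstLp (μ := μ01) 2
      (measurableSet_Ioc (a := (0 : ℝ)) (b := y)) (measure_ne_top _ _) (1 : ℝ)) 2 μ01 := by
    have hm : AEStronglyMeasurable (fun y => (√(a y))⁻¹ • indicatorConstLp (μ := μ01) 2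
        (measurableSet_Ioc (a := (0 : ℝ)) (b := y)) (measure_ne_top _ _) (1 : ℝ)) μ01 :=
      (((continuousOn_inv_sqrt ha hpos).mono Ioo_subset_Ioc_self).aestronglyMeasurable
        measurableSet_Ioo).smul continuous_indicatorConstLp_Ioc.aestronglyMeasurable
    rw [memLp_two_iff_integrable_sq_norm hm]
    -- The squared norm of the kernel at `y` is `y / a y`, as `‖1_(0,y]‖² = y`.
    refine hint.congr ?_
    filter_upwards [ae_restrict_mem measurableSet_Ioo] with y hy
    have hy' := hpos y (Ioo_subset_Ioc_self hy)
    have hv : μ01 (Ioc 0 y) = ENNReal.ofReal y := by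
      rw [Measure.restrict_apply measurableSet_Ioc, inter_eq_left.2, Real.volume_Ioc, sub_zero]
      exact fun x hx => ⟨hx.1, hx.2.trans_lt hy.2⟩
    have hn : ‖indicatorConstLp (μ := μ01) 2 (measurableSet_Ioc (a := (0 : ℝ)) (b := y))
        (measure_ne_top _ _) (1 : ℝ)‖ = √y := by
      rw [norm_indicatorConstLp two_ne_zero ENNReal.ofNat_ne_top, measureReal_def, hv,
        ENNReal.toReal_ofReal hy.1.le, Real.sqrt_eq_rpow]
      simp
    rw [norm_smul, hn, mul_pow, Real.sq_sqrt hy.1.le, norm_inv,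
      Real.norm_of_nonneg (Real.sqrt_nonneg _), inv_pow, Real.sq_sqrt hy'.le, div_eq_inv_mul]
  refine ⟨kernelOp L2 μ01 (hk.toLp _), isCompactOperator_kernelOp _, fun f => ?_⟩
  filter_upwards [coeFn_kernelOp (hk.toLp _) f, hk.coeFn_toLp, ae_restrict_mem measurableSet_Ioo]
    with y h1 h2 hy
  rw [h1, h2, inner_smul_right, inner_indicatorConstLp_Ioc f hy]

/-- Integration by parts for the two primitives, each vanishing at one endpoint. -/
theorem integral_mul_integral_swap {f g : ℝ → ℝ} {c d : ℝ}
    (hf : IntervalIntegrable f volume c d) (hg : IntervalIntegrable g volume c d) :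
    ∫ x in c..d, f x * ∫ y in x..d, g y = ∫ y in c..d, g y * ∫ x in c..y, f x := by
  have hF := hf.absolutelyContinuousOnInterval_intervalIntegral (c := c) left_mem_uIcc
  have hG := hg.absolutelyContinuousOnInterval_intervalIntegral (c := d) right_mem_uIcc
  have key := hG.integral_mul_deriv_eq_deriv_mul hF
  rw [intervalIntegral.integral_same, intervalIntegral.integral_same, zero_mul, mul_zero, sub_zero,
    zero_sub] at key
  have h1 : ∫ x in c..d, (∫ y in d..x, g y) * deriv (fun x => ∫ y in c..x, f y) x =
      -∫ x in c..d, f x * ∫ y in x..d, g y := by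
    rw [← intervalIntegral.integral_neg]
    refine intervalIntegral.integral_congr_ae ?_
    filter_upwards [hf.ae_hasDerivAt_integral] with x hx hxc
    rw [(hx (uIoc_subset_uIcc hxc) c left_mem_uIcc).deriv, intervalIntegral.integral_symm]
    ring
  have h2 : ∫ x in c..d, deriv (fun x => ∫ y in d..x, g y) x * (∫ y in c..x, f y) =
      ∫ y in c..d, g y * ∫ x in c..y, f x := by
    refine intervalIntegral.integral_congr_ae ?_
    filter_upwards [hg.ae_hasDerivAt_integral] with x hx hxc
    rw [(hx (uIoc_subset_uIcc hxc) d right_mem_uIcc).deriv]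
  rw [h1, h2] at key
  exact neg_injective key

/-- The function `a^(-1/2) h` need not be integrable near `0`. The two sides are therefore compared
on each `(δ, 1)`, by testing with indicators of subsets, and then `δ → 0`. -/
theorem adjoint_weightedPrimitive (ha : ContinuousOn a (Ioc 0 1))
    (hpos : ∀ x ∈ Ioc (0 : ℝ) 1, 0 < a x) {S : L2 →L[ℝ] L2}
    (hS : ∀ f : L2, S f =ᵐ[μ01] fun y => (√(a y))⁻¹ * ∫ x in 0..y, f x) (h : L2) :
    ContinuousLinearMap.adjoint S h =ᵐ[μ01] fun x => ∫ y in x..1, (√(a y))⁻¹ * h y := by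
  set V : ℝ → ℝ := fun x => ∫ y in x..1, (√(a y))⁻¹ * h y with hV
  set v := ContinuousLinearMap.adjoint S h
  have key : ∀ δ ∈ Ioo (0 : ℝ) 1, ∀ E ⊆ Ioo δ 1, MeasurableSet E →
      ∫ x in E, v x = ∫ x in E, V x := by
    intro δ hδ E hE hEm
    have hE01 : E ⊆ Ioo 0 1 := hE.trans (Ioo_subset_Ioo_left hδ.1.le)
    set f : L2 := indicatorConstLp 2 hEm (measure_ne_top _ _) (1 : ℝ)
    have hf : f =ᵐ[μ01] E.indicator fun _ => (1 : ℝ) := indicatorConstLp_coeFn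
    have hfi : ∀ y ∈ Icc (0 : ℝ) 1, ∫ x in 0..y, f x = ∫ x in 0..y, E.indicator (fun _ => (1 : ℝ)) x := by
      intro y hy
      rw [intervalIntegral.integral_of_le hy.1, intervalIntegral.integral_of_le hy.1,
        integral_Ioc_eq_integral_Ioo, integral_Ioc_eq_integral_Ioo]
      exact integral_congr_ae (ae_restrict_of_ae_restrict_of_subset (Ioo_subset_Ioo_right hy.2) hf)
    -- Cutting off below `δ` restores integrability and changes nothing, since the primitive of
    -- `1_E` vanishes there.
    set g : ℝ → ℝ := (Ioi δ).indicator fun y => (√(a y))⁻¹ * h y with hg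
    have hgi : IntervalIntegrable g volume 0 1 := by
      rw [intervalIntegrable_iff_integrableOn_Ioc_of_le zero_le_one, hg,
        integrableOn_indicator_iff measurableSet_Ioi]
      have := intervalIntegrable_inv_sqrt_mul ha hpos h (Ioo_subset_Ioc_self hδ)
      rw [intervalIntegrable_iff_integrableOn_Ioc_of_le hδ.2.le] at this
      exact this.mono_set fun x hx => ⟨hx.1, hx.2.2⟩
    have hswap := integral_mul_integral_swap
      (f := E.indicator fun _ => (1 : ℝ)) (g := g) (by
        rw [intervalIntegrable_iff_integrableOn_Ioc_of_le zero_le_one]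
        exact (integrable_const (μ := volume.restrict (Ioc 0 1)) (1 : ℝ)).indicator hEm) hgi
    have hl : ∫ x in 0..1, E.indicator (fun _ => (1 : ℝ)) x * ∫ y in x..1, g y = ∫ x in E, V x := by
      rw [intervalIntegral.integral_of_le zero_le_one, integral_Ioc_eq_integral_Ioo,
        ← inter_eq_right.2 hE01, ← setIntegral_indicator hEm, inter_eq_right.2 hE01]
      refine setIntegral_congr_fun measurableSet_Ioo fun x hx => ?_
      by_cases hxE : x ∈ E
      · simp only [indicator_of_mem hxE, one_mul, hV]
        refine intervalIntegral.integral_congr_ae (Filter.Eventually.of_forall fun y hy => ?_)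
        rw [uIoc_of_le hx.2.le] at hy
        exact indicator_of_mem (show y ∈ Ioi δ from (hE hxE).1.trans hy.1) _
      · simp [indicator_of_notMem hxE]
    have hr : ∫ y in 0..1, g y * ∫ x in 0..y, E.indicator (fun _ => (1 : ℝ)) x = ⟪h, S f⟫_ℝ := by
      rw [intervalIntegral.integral_of_le zero_le_one, integral_Ioc_eq_integral_Ioo, L2.inner_def]
      refine integral_congr_ae ?_
      filter_upwards [hS f, ae_restrict_mem measurableSet_Ioo] with y h1 hy
      rw [h1, hfi y (Ioo_subset_Icc_self hy), hg]
      by_cases hyδ : y ∈ Ioi δ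
      · rw [indicator_of_mem hyδ]
        simp only [RCLike.inner_apply, conj_trivial]
        ring
      · have h0 : ∫ x in 0..y, E.indicator (fun _ => (1 : ℝ)) x = 0 := by
          rw [intervalIntegral.integral_of_le hy.1.le]
          refine setIntegral_eq_zero_of_forall_eq_zero fun x hx => indicator_of_notMem ?_ _
          exact fun hxE => hyδ ((hE hxE).1.trans_le hx.2)
        rw [h0]
        simp
    have hvE : ∫ x in E, v x = ⟪v, f⟫_ℝ := by
      rw [real_inner_comm, L2.inner_indicatorConstLp_one, Measure.restrict_restrict hEm,
        inter_eq_left.2 hE01]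
    rw [hvE, ContinuousLinearMap.adjoint_inner_left, ← hr, ← hswap, hl]
  have hδ : ∀ δ ∈ Ioo (0 : ℝ) 1, v =ᵐ[volume.restrict (Ioo δ 1)] V := by
    intro δ hδ
    have hi := intervalIntegrable_inv_sqrt_mul ha hpos h (Ioo_subset_Ioc_self hδ)
    refine Integrable.ae_eq_of_forall_setIntegral_eq _ _ ?_ ?_ fun s hs _ => ?_
    · exact ((Lp.memLp v).integrable one_le_two).mono_measure
        (Measure.restrict_mono (Ioo_subset_Ioo_left hδ.1.le) le_rfl)
    · have hc : ContinuousOn V (Icc δ 1) := by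
        have := (hi.absolutelyContinuousOnInterval_intervalIntegral (c := 1)
          right_mem_uIcc).continuousOn.neg
        rw [uIcc_of_le hδ.2.le] at this
        refine this.congr fun x _ => ?_
        exact intervalIntegral.integral_symm _ _
      exact (hc.integrableOn_Icc).mono_set Ioo_subset_Icc_self
    · rw [Measure.restrict_restrict hs]
      exact key δ hδ _ inter_subset_right (hs.inter measurableSet_Ioo)
  rw [Filter.EventuallyEq, ae_restrict_iff' measurableSet_Ioo]
  -- The shift by `2` keeps the left endpoint strictly below `1` even for `n = 0`.
  have hall : ∀ n : ℕ, ∀ᵐ x, x ∈ Ioo (1 / ((n : ℝ) + 2)) 1 → v x = V x := fun n => by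
    rw [← ae_restrict_iff' measurableSet_Ioo]
    refine hδ _ ⟨by positivity, ?_⟩
    rw [div_lt_one (by positivity)]
    linarith [(Nat.cast_nonneg n : (0 : ℝ) ≤ n)]
  filter_upwards [ae_all_iff.2 hall] with x hx hx01
  obtain ⟨n, hn⟩ := exists_nat_one_div_lt hx01.1
  refine hx n ⟨lt_of_le_of_lt ?_ hn, hx01.2⟩
  exact one_div_le_one_div_of_le (by positivity) (by linarith)

end Primitive

/-! ### The compact inverse of the degenerate operator -/

section Operator

variable {κ : Degeneracy} {a : ℝ → ℝ}

theorem L2.eq_zero_of_primitive_ae_eq_const {f : L2} {c : ℝ}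
    (h : ∀ᵐ x ∂μ01, ∫ t in 0..x, f t = c) : f = 0 := by
  have hf := f.intervalIntegrable
  have hc : ContinuousOn (fun x => ∫ t in 0..x, f t) (Ioo 0 1) := by
    have := (hf.absolutelyContinuousOnInterval_intervalIntegral (c := 0) left_mem_uIcc).continuousOn
    rw [uIcc_of_le zero_le_one] at this
    exact this.mono Ioo_subset_Icc_self
  have heq : EqOn (fun x => ∫ t in 0..x, f t) (fun _ => c) (Ioo 0 1) :=
    Measure.eqOn_open_of_ae_eq h isOpen_Ioo hc continuousOn_const
  apply (Lp.eq_zero_iff_ae_eq_zero).2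
  filter_upwards [ae_restrict_mem measurableSet_Ioo, ae_restrict_of_ae hf.ae_hasDerivAt_integral]
    with x hx hd
  rw [uIcc_of_le zero_le_one] at hd
  have h1 := hd (Ioo_subset_Icc_self hx) 0 (left_mem_Icc.2 zero_le_one)
  have h2 : HasDerivAt (fun x => ∫ t in 0..x, f t) 0 x :=
    (hasDerivAt_const x c).congr_of_eventuallyEq (heq.eventuallyEq_of_mem (Ioo_mem_nhds hx.1 hx.2))
  exact h1.unique h2

theorem hasDerivAt_integral_right_of_forall {g : ℝ → ℝ}
    (hg : ∀ δ ∈ Ioc (0 : ℝ) 1, IntervalIntegrable g volume δ 1) :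
    ∀ᵐ x ∂μ01, HasDerivAt (fun x => ∫ y in x..1, g y) (-g x) x := by
  rw [ae_restrict_iff' measurableSet_Ioo]
  have hn : ∀ n : ℕ, ∀ᵐ x, x ∈ Ioo (1 / ((n : ℝ) + 1)) 1 →
      HasDerivAt (fun x => ∫ y in x..1, g y) (-g x) x := by
    intro n
    have h1 : 1 / ((n : ℝ) + 1) ≤ 1 := by
      rw [div_le_one (by positivity)]
      linarith [(Nat.cast_nonneg n : (0 : ℝ) ≤ n)]
    filter_upwards [(hg _ ⟨by positivity, h1⟩).ae_hasDerivAt_integral] with x hx hxn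
    rw [uIcc_of_le h1] at hx
    have := (hx (Ioo_subset_Icc_self hxn) 1 (right_mem_Icc.2 h1)).neg
    refine this.congr_of_eventuallyEq (Filter.Eventually.of_forall fun y => ?_)
    exact intervalIntegral.integral_symm _ _
  filter_upwards [ae_all_iff.2 hn] with x hx hx01
  obtain ⟨n, hn⟩ := exists_nat_one_div_lt hx01.1
  exact hx n ⟨hn, hx01.2⟩

theorem WeaklyDegenerate.memLp_inv_sqrt (h : WeaklyDegenerate a) :
    MemLp (fun x => (√(a x))⁻¹) 2 μ01 := by
  rw [memLp_two_iff_integrable_sq (((continuousOn_inv_sqrt h.2.1.continuousOn h.2.2.1).mono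
    Ioo_subset_Ioc_self).aestronglyMeasurable measurableSet_Ioo)]
  refine h.integrable_inv.congr ?_
  filter_upwards [ae_restrict_mem measurableSet_Ioo] with x hx
  rw [inv_pow, Real.sq_sqrt (h.2.2.1 x (Ioo_subset_Ioc_self hx)).le]

/-- For `U x = ∫ₓ¹ a^(-1/2) h` one has `√a U' = -h ∈ L²` and `a U' = c - ∫₀ˣ f`, whose derivative is
`-f`. The hypothesis `hweak` is the boundary condition `U 0 = 0`. -/
theorem isM_adjoint_weightedPrimitive (hκ : κ.Holds a) {S : L2 →L[ℝ] L2}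
    (hS : ∀ f : L2, S f =ᵐ[μ01] fun y => (√(a y))⁻¹ * ∫ x in 0..y, f x) {f h : L2} {c : ℝ}
    (hh : h =ᵐ[μ01] fun y => (√(a y))⁻¹ * ((∫ x in 0..y, f x) - c))
    (hweak : κ = .weak → ∫ y in 0..1, (√(a y))⁻¹ * h y = 0) :
    IsM κ a (ContinuousLinearMap.adjoint S h) (-f) := by
  have hc := hκ.contDiffOn.continuousOn
  have hpos := hκ.pos
  have hg := fun δ (hδ : δ ∈ Ioc (0 : ℝ) 1) => intervalIntegrable_inv_sqrt_mul hc hpos h hδ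
  have hac : ∀ δ, IntervalIntegrable (fun y => (√(a y))⁻¹ * h y) volume δ 1 →
      AbsolutelyContinuousOnInterval (fun x => ∫ y in x..1, (√(a y))⁻¹ * h y) δ 1 := by
    intro δ hi
    have := (hi.absolutelyContinuousOnInterval_intervalIntegral (c := 1) right_mem_uIcc).neg
    have heq : (fun x => ∫ y in x..1, (√(a y))⁻¹ * h y) =
        -fun x => ∫ y in (1 : ℝ)..x, (√(a y))⁻¹ * h y :=
      funext fun x => intervalIntegral.integral_symm _ _
    rwa [heq]
  have hd := hasDerivAt_integral_right_of_forall hg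
  have hf := f.intervalIntegrable
  have hF := hf.absolutelyContinuousOnInterval_intervalIntegral (c := 0) left_mem_uIcc
  have hconst : AbsolutelyContinuousOnInterval (fun _ : ℝ => c) 0 1 :=
    (LipschitzWith.const' (K := 0) c).lipschitzOnWith.absolutelyContinuousOnInterval
  have hdW : ∀ᵐ x ∂μ01, HasDerivAt (fun x => c - ∫ t in 0..x, f t) (-f x) x := by
    filter_upwards [ae_restrict_mem measurableSet_Ioo, ae_restrict_of_ae hf.ae_hasDerivAt_integral]
      with x hx hd
    rw [uIcc_of_le zero_le_one] at hd
    exact (hd (Ioo_subset_Icc_self hx) 0 (left_mem_Icc.2 zero_le_one)).const_sub c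
  refine ⟨fun x => ∫ y in x..1, (√(a y))⁻¹ * h y, fun x => c - ∫ t in 0..x, f t,
    adjoint_weightedPrimitive hc hpos hS h, ⟨?_, ?_⟩, ⟨hconst.sub hF, ?_⟩, ?_, ?_⟩
  · cases κ with
    | weak =>
      refine ⟨hac 0 ?_, hweak rfl, intervalIntegral.integral_same⟩
      rw [intervalIntegrable_iff_integrableOn_Ioo_of_le zero_le_one]
      exact (WeaklyDegenerate.memLp_inv_sqrt hκ).integrable_mul (Lp.memLp h)
    | strong => exact ⟨fun δ hδ => hac δ (hg δ hδ), intervalIntegral.integral_same⟩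
  · refine (Lp.memLp h).neg.ae_eq ?_
    filter_upwards [hd, ae_restrict_mem measurableSet_Ioo] with x hx hx01
    have := (Real.sqrt_pos.2 (hpos x (Ioo_subset_Ioc_self hx01))).ne'
    rw [hx.deriv, Pi.neg_apply]
    field_simp
  · refine (Lp.memLp f).neg.ae_eq ?_
    filter_upwards [hdW] with x hx
    rw [hx.deriv, Pi.neg_apply]
  · filter_upwards [hd, ae_restrict_mem measurableSet_Ioo, hh] with x hx hx01 hhx
    have h1 := hpos x (Ioo_subset_Ioc_self hx01)
    have h2 := (Real.sqrt_pos.2 h1).ne'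
    rw [hx.deriv, hhx]
    nth_rewrite 1 [← Real.mul_self_sqrt h1.le]
    field_simp
    ring
  · filter_upwards [hdW, Lp.coeFn_neg f] with x hx hfx
    rw [hx.deriv, hfx, Pi.neg_apply]

theorem eq_zero_of_deriv_eq_zero {U : ℝ → ℝ} {δ : ℝ} (hδ : δ ∈ Icc (0 : ℝ) 1)
    (hU : AbsolutelyContinuousOnInterval U δ 1) (h1 : U 1 = 0)
    (hd : ∀ᵐ x ∂μ01, deriv U x = 0) : ∀ x ∈ Icc δ 1, U x = 0 := by
  intro x hx
  have hsub : uIcc x 1 ⊆ uIcc δ 1 := by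
    rw [uIcc_of_le hx.2, uIcc_of_le hδ.2]
    exact Icc_subset_Icc_left hx.1
  have key := (hU.mono hsub).integral_deriv_eq_sub
  have h0 : ∫ t in x..1, deriv U t = 0 := by
    rw [intervalIntegral.integral_of_le hx.2, integral_Ioc_eq_integral_Ioo]
    exact integral_eq_zero_of_ae
      (ae_restrict_of_ae_restrict_of_subset (Ioo_subset_Ioo_left (hδ.1.trans hx.1)) hd)
  rw [h0, h1, zero_sub] at key
  exact neg_eq_zero.1 key.symm

/-- The flux `a U'` is a constant `c`. In the weak case `0 = U 1 - U 0 = c ∫ 1/a`; in the strong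
case `(√a U')² = c²/a` is integrable while `1/a` is not. Either way `c = 0`, and `U 1 = 0` finishes.
-/
theorem IsM.eq_zero (hκ : κ.Holds a) {u : L2} (h : IsM κ a u 0) : u = 0 := by
  obtain ⟨U, W, hu, hU, hW, hWU, hf⟩ := h
  have hpos := hκ.pos
  obtain ⟨c, hc⟩ : ∃ c, ∀ x ∈ uIcc (0 : ℝ) 1, W x = c := by
    refine hW.1.const_of_ae_hasDerivAt_zero ?_
    have h1 : ∀ᵐ x ∂μ01, HasDerivAt W 0 x := by
      filter_upwards [hW.ae_differentiableAt, hf, Lp.coeFn_zero ℝ 2 μ01] with x hx hx1 hx2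
      have := hx.hasDerivAt
      rwa [← hx1, hx2] at this
    rw [ae_restrict_iff' measurableSet_Ioo] at h1
    have h2 : ∀ᵐ x : ℝ, x ≠ 0 := by simp [ae_iff]
    have h3 : ∀ᵐ x : ℝ, x ≠ 1 := by simp [ae_iff]
    filter_upwards [h1, h2, h3] with x hx hx0 hx1 hxI
    rw [uIcc_of_le zero_le_one] at hxI
    exact hx ⟨lt_of_le_of_ne hxI.1 hx0.symm, lt_of_le_of_ne hxI.2 hx1⟩
  rw [uIcc_of_le zero_le_one] at hc
  have hd : ∀ᵐ x ∂μ01, deriv U x = c * (a x)⁻¹ := by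
    filter_upwards [hWU, ae_restrict_mem measurableSet_Ioo] with x hx hx01
    rw [← hc x (Ioo_subset_Icc_self hx01), hx, mul_comm (a x), mul_assoc,
      mul_inv_cancel₀ (hpos x (Ioo_subset_Ioc_self hx01)).ne', mul_one]
  have hc0 : c = 0 := by
    cases κ with
    | weak =>
      have key := hU.1.1.integral_deriv_eq_sub
      rw [hU.1.2.1, hU.1.2.2, sub_zero, intervalIntegral.integral_of_le zero_le_one,
        integral_Ioc_eq_integral_Ioo, integral_congr_ae hd, integral_const_mul] at key
      refine (mul_eq_zero.1 key).resolve_right (ne_of_gt ?_)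
      refine (setIntegral_pos_iff_support_of_nonneg_ae ?_
        (WeaklyDegenerate.integrable_inv hκ)).2 ?_
      · filter_upwards [ae_restrict_mem measurableSet_Ioo] with x hx
        exact (inv_pos.2 (hpos x (Ioo_subset_Ioc_self hx))).le
      · rw [inter_eq_right.2]
        · simp
        · exact fun x hx => (inv_pos.2 (hpos x (Ioo_subset_Ioc_self hx))).ne'
    | strong =>
      by_contra hc0
      apply StronglyDegenerate.not_integrable_inv hκ
      have := hU.2.integrable_sq.const_mul (c ^ 2)⁻¹
      refine this.congr ?_
      filter_upwards [hd, ae_restrict_mem measurableSet_Ioo] with x hx hx01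
      have h1 := hpos x (Ioo_subset_Ioc_self hx01)
      rw [hx, mul_pow, Real.sq_sqrt h1.le]
      field_simp
  have hd0 : ∀ᵐ x ∂μ01, deriv U x = 0 := by
    filter_upwards [hd] with x hx
    rw [hx, hc0, zero_mul]
  have hU0 : ∀ x ∈ Ioo (0 : ℝ) 1, U x = 0 := by
    intro x hx
    cases κ with
    | weak =>
      exact eq_zero_of_deriv_eq_zero (left_mem_Icc.2 zero_le_one) hU.1.1 hU.1.2.2 hd0 x
        (Ioo_subset_Icc_self hx)
    | strong =>
      exact eq_zero_of_deriv_eq_zero (Ioo_subset_Icc_self hx) (hU.1.1 x (Ioo_subset_Ioc_self hx))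
        hU.1.2 hd0 x (left_mem_Icc.2 hx.2.le)
  apply (Lp.eq_zero_iff_ae_eq_zero).2
  filter_upwards [hu, ae_restrict_mem measurableSet_Ioo] with x hx hx01
  rw [hx, hU0 x hx01, Pi.zero_apply]

/-- The space of constants `c` of the first integrals `a uₓ + ∫₀ f = c`, weighted by `a^(-1/2)`. -/
theorem Degeneracy.Holds.exists_boundarySpace (hκ : κ.Holds a) :
    ∃ (V : Submodule ℝ L2) (_ : V.HasOrthogonalProjection),
      (∀ z ∈ V, ∃ c : ℝ, z =ᵐ[μ01] fun y => (√(a y))⁻¹ * c) ∧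
      (κ = .weak → ∀ h ∈ Vᗮ, ∫ y in 0..1, (√(a y))⁻¹ * h y = 0) := by
  cases κ with
  | weak =>
    have hw := WeaklyDegenerate.memLp_inv_sqrt hκ
    -- Orthogonality to `a^(-1/2)` is exactly the condition `U 0 = 0` for `U x = ∫ₓ¹ a^(-1/2) h`.
    refine ⟨Submodule.span ℝ {hw.toLp _}, inferInstance, fun z hz => ?_, fun _ h hh => ?_⟩
    · obtain ⟨c, rfl⟩ := Submodule.mem_span_singleton.1 hz
      refine ⟨c, ?_⟩
      filter_upwards [Lp.coeFn_smul c (hw.toLp _), hw.coeFn_toLp] with x h1 h2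
      rw [h1, Pi.smul_apply, h2, smul_eq_mul, mul_comm]
    · have := (Submodule.mem_orthogonal _ _).1 hh _ (Submodule.mem_span_singleton_self _)
      rw [L2.inner_def] at this
      rw [intervalIntegral.integral_of_le zero_le_one, integral_Ioc_eq_integral_Ioo]
      refine (integral_congr_ae ?_).trans this
      filter_upwards [hw.coeFn_toLp] with x hx
      rw [hx]
      simp [mul_comm]
  | strong =>
    -- No condition is imposed on `U` at `0`; the flux constant is `c = 0`.
    refine ⟨⊥, inferInstance, fun z hz => ⟨0, ?_⟩, fun h => by cases h⟩
    rw [(Submodule.mem_bot ℝ).1 hz]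
    filter_upwards [Lp.coeFn_zero ℝ 2 μ01] with x hx
    rw [hx, Pi.zero_apply, mul_zero]

/-- The inverse is `R* R` with `R = Q S`: symmetric by its form, compact because `S` is. -/
theorem Degeneracy.Holds.exists_hasCompactInverseNeg (hκ : κ.Holds a) :
    ∃ G : L2 →L[ℝ] L2, HasCompactInverseNeg (opM κ a) G := by
  obtain ⟨S, hSc, hS⟩ := exists_weightedPrimitive hκ.contDiffOn.continuousOn hκ.pos
    hκ.integrable_self_div
  obtain ⟨V, _, hV, hVw⟩ := hκ.exists_boundarySpace
  set Q := Vᗮ.starProjection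
  set R : L2 →L[ℝ] L2 := Q ∘L S with hR
  have hGR : ∀ x y, ⟪ContinuousLinearMap.adjoint R (R x), y⟫_ℝ = ⟪R x, R y⟫_ℝ := fun x y =>
    ContinuousLinearMap.adjoint_inner_left _ _ _
  -- `R* R = S* Q Q S = S* Q S`, because `Q` is an orthogonal projection.
  have hRS : ∀ f, ContinuousLinearMap.adjoint R (R f) = ContinuousLinearMap.adjoint S (R f) := by
    intro f
    refine ext_inner_right ℝ fun y => ?_
    rw [hGR, ContinuousLinearMap.adjoint_inner_left]
    change ⟪Q (S f), Q (S y)⟫_ℝ = ⟪Q (S f), S y⟫_ℝ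
    rw [← Submodule.inner_starProjection_left_eq_right,
      Submodule.starProjection_eq_self_iff.2 (Submodule.starProjection_apply_mem _ _)]
  have hSR : ∀ f, ∃ c : ℝ, R f =ᵐ[μ01] fun y => (√(a y))⁻¹ * ((∫ x in 0..y, f x) - c) := by
    intro f
    obtain ⟨c, hc⟩ := hV (V.starProjection (S f)) (Submodule.starProjection_apply_mem _ _)
    have hsplit : R f = S f - V.starProjection (S f) := by
      rw [eq_sub_iff_add_eq, add_comm]
      exact V.starProjection_add_starProjection_orthogonal (S f)
    refine ⟨c, ?_⟩
    rw [hsplit]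
    filter_upwards [Lp.coeFn_sub (S f) (V.starProjection (S f)), hS f, hc] with x h1 h2 h3
    rw [h1, Pi.sub_apply, h2, h3, mul_sub]
  have hinj : ∀ f, ContinuousLinearMap.adjoint R (R f) = 0 → f = 0 := by
    intro f hf
    have h0 : R f = 0 := by
      rw [← inner_self_eq_zero (𝕜 := ℝ), ← hGR, hf, inner_zero_left]
    obtain ⟨c, hc⟩ := hSR f
    refine L2.eq_zero_of_primitive_ae_eq_const (c := c) ?_
    rw [h0] at hc
    filter_upwards [hc, Lp.coeFn_zero ℝ 2 μ01, ae_restrict_mem measurableSet_Ioo] with x h1 h2 hx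
    rw [h2, Pi.zero_apply, eq_comm, mul_eq_zero] at h1
    have := inv_ne_zero (Real.sqrt_pos.2 (hκ.pos x (Ioo_subset_Ioc_self hx))).ne'
    exact sub_eq_zero.1 (h1.resolve_left this)
  have hM : ∀ f, (ContinuousLinearMap.adjoint R (R f), -f) ∈ graphM κ a := by
    intro f
    rw [hRS]
    obtain ⟨c, hc⟩ := hSR f
    exact isM_adjoint_weightedPrimitive hκ hS hc fun hw =>
      hVw hw _ (Submodule.starProjection_apply_mem _ _)
  -- If `(0, f)` is in `graphM`, adding `(R* R f, -f)` gives `(R* R f, 0)`, so `R* R f = 0` and `f =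
  -- 0`: the graph is single-valued.
  have hgraph : (opM κ a).graph = graphM κ a := by
    refine Submodule.toLinearPMap_graph_eq _ ?_
    rintro ⟨u, f⟩ huf rfl
    have h1 := (graphM κ a).add_mem huf (hM f)
    rw [Prod.mk_add_mk, zero_add, add_neg_cancel] at h1
    exact hinj f (IsM.eq_zero hκ h1)
  refine ⟨ContinuousLinearMap.adjoint R ∘L R, ?_, fun x y => ?_, fun f => ?_, fun u hu => ?_⟩
  · exact (hSc.clm_comp Q).clm_comp (ContinuousLinearMap.adjoint R)
  · change ⟪ContinuousLinearMap.adjoint R (R x), y⟫_ℝ = ⟪x, ContinuousLinearMap.adjoint R (R y)⟫_ℝ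
    rw [hGR, ContinuousLinearMap.adjoint_inner_right]
  · rw [hgraph]
    exact hM f
  · rw [hgraph] at hu
    exact IsM.eq_zero hκ hu

end Operator

end DegenerateKalman

theorem proposition2p2 (κ : DegenerateKalman.Degeneracy) (a : ℝ → ℝ) (ha : κ.Holds a)
    (n m : ℕ) (D A : Matrix (Fin n) (Fin n) ℝ) (hD : DegenerateKalman.IsPosDiagonalizable D)
    (B : Matrix (Fin n) (Fin m) ℝ) :
    List.TFAE [
      DegenerateKalman.pker (DegenerateKalman.kalmanOp κ a D A B).adjoint = ⊥,
      DegenerateKalman.pker (DegenerateKalman.pcomp (DegenerateKalman.kalmanOp κ a D A B)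
        (DegenerateKalman.kalmanOp κ a D A B).adjoint) = ⊥,
      ∀ ev : ℝ, DegenerateKalman.IsEigenvalueNeg (DegenerateKalman.opM κ a) ev →
        (DegenerateKalman.kalmanMatrix (-(ev • D) + A) B *
          (DegenerateKalman.kalmanMatrix (-(ev • D) + A) B).transpose).det ≠ 0] := by
  obtain ⟨G, hG⟩ := ha.exists_hasCompactInverseNeg
  exact hG.kalman_tfae
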